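/- \textbf{Definitions.} Formulas over a finite alphabet $\Sigma$ are built from letters $p_0,p_1,\dots$ by $\bot$, $\to$ and $\Box_e$ ($e\in\Sigma$). A \emph{logic} over $\Sigma$ is a set of such formulas containing all classical tautologies and all $\Box_e(p\to q)\to(\Box_e p\to\Box_e q)$, closed under modus ponens, substitution and necessitation. A \emph{frame} $F=(W,(R_e)_{e\in\Sigma})$ has $W\neq\varnothing$ and $R_e\subseteq W\times W$; a \emph{model} adds a valuation; truth and validity are as usual in Kripke semantics. $\mathsf{Fr}(L)$ is the class of frames on which all formulas of $L$ are valid. $L$ has the \emph{finite model property} if it is the set of formulas valid on all members of some class of finite frames. $L$ is \emph{canonical} if it is valid on its canonical frame: its points are the sets $x\supseteq L$ of formulas that are closed under modus ponens and contain exactly one of $\varphi,\neg\varphi$ for each $\varphi$, and $x\,R_e\,y$ iff $\varphi\in y$ whenever $\Box_e\varphi\in x$. (The inconsistent logic, which has no such points, counts as canonical.) For a model $M=(W,(R_e),V)$ and a set $\Gamma$ of formulas, $x\sim_\Gamma y$ means that $x$ and $y$ satisfy the same formulas of $\Gamma$ in $M$; write $\hat x$ for the $\sim_\Gamma$-class of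 $x$. For $\Gamma$ finite and closed under subformulas, a \emph{strict $\Gamma$-filtration} of $M$ is a model on $W/{\sim_\Gamma}$ with relations $\hat R_e$ such that (i) a variable $p\in\Gamma$ is true at $\hat x$ iff it is true at $x$; (ii) $x\,R_e\,y$ implies $\hat x\,\hat R_e\,\hat y$; (iii) if $\hat x\,\hat R_e\,\hat y$, $\Box_e\varphi\in\Gamma$ and $M,x\models\Box_e\varphi$, then $M,y\models\varphi$. A class $\mathcal F$ of frames \emph{admits strict filtration} if, for every finite subformula-closed $\Gamma$, every model on a frame of $\mathcal F$ has a strict $\Gamma$-filtration whose frame is in $\mathcal F$. The \emph{fusion} $L_1*\dots*L_k$ of logics over finite alphabets $\Sigma_1,\dots,\Sigma_k$ (made disjoint) is the smallest logic over $\Sigma_1\cup\dots\cup\Sigma_k$ containing all $L_i$. For an alphabet $\Sigma$, let $\Sigma^\sharp$ be $\Sigma$ together with new symbols $e\circ c$, $e\cup c$, $e^+$ for all $e,c\in\Sigma$. For a logic $L$ over $\Sigma$, let $L^\sharp$ be the smallest logic over $\Sigma^\sharp$ that contains $L$ and, for all $e,c\in\Sigma$, the axioms $$\Box_{e\cup c}p\leftrightarrow\Box_e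 p\wedge\Box_c p,\quad \Box_{e\circ c}p\leftrightarrow\Box_e\Box_c p,\quad \Box_{e^+}p\to\Box_e p,\quad \Box_{e^+}p\to\Box_e\Box_{e^+}p,\quad \Box_{e^+}(p\to\Box_e p)\to(\Box_e p\to\Box_{e^+}p).$$ Put $L^{(0)}=L$ and $L^{(n+1)}=(L^{(n)})^\sharp$. \textbf{Theorem.} Let $L_1,\dots,L_k$ be canonical logics over finite alphabets such that each class $\mathsf{Fr}(L_i)$, $1\le i\le k$, admits strict filtration. Then, for every $n<\omega$, the logic $(L_1*\dots*L_k)^{(n)}$ has the finite model property. -/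

import Mathlib

namespace ModalPDL

/-! ### Formulas -/

/-- Modal formulas over an alphabet `A` of modality indices, with propositional letters
`p_0, p_1, ...` indexed by `ℕ`. -/
inductive Form (A : Type) : Type where
  | bot : Form A
  | var : ℕ → Form A
  | imp : Form A → Form A → Form A
  | box : A → Form A → Form A

namespace Form

variable {A B : Type}

/-- Negation `φ → ⊥`. -/
def neg (φ : Form A) : Form A := imp φ bot

/-- Conjunction `¬(φ → ¬ψ)`. -/
def and (φ ψ : Form A) : Form A := neg (imp φ (neg ψ))

/-- Biconditional `(φ → ψ) ∧ (ψ → φ)`. -/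
def iff (φ ψ : Form A) : Form A := and (imp φ ψ) (imp ψ φ)

/-- Uniform substitution of formulas for propositional letters. -/
def subst (σ : ℕ → Form A) : Form A → Form A
  | bot => bot
  | var p => σ p
  | imp φ ψ => imp (subst σ φ) (subst σ ψ)
  | box e φ => box e (subst σ φ)

/-- Renaming of the modalities along a map of alphabets. -/
def rename (f : A → B) : Form A → Form B
  | bot => bot
  | var p => var p
  | imp φ ψ => imp (rename f φ) (rename f ψ)
  | box e φ => box (f e) (rename f φ)

/-- The set of all subformulas of a formula, the formula itself included. -/
def subformulas : Form A → Set (Form A)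
  | bot => {bot}
  | var p => {var p}
  | imp φ ψ => {imp φ ψ} ∪ (subformulas φ ∪ subformulas ψ)
  | box e φ => {box e φ} ∪ subformulas φ

/-- Classical tautologies: formulas true under all Boolean valuations, where propositional letters
and boxed formulas are evaluated arbitrarily. -/
def IsTautology (φ : Form A) : Prop :=
  ∀ v : Form A → Prop, ¬ v bot → (∀ α β : Form A, v (imp α β) ↔ (v α → v β)) → v φ

end Form

/-- A set of formulas is `Sub`-closed if it contains all subformulas of its members. -/
def SubClosed {A : Type} (Γ : Set (Form A)) : Prop :=
  ∀ φ ∈ Γ, φ.subformulas ⊆ Γ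

/-! ### Kripke semantics -/

/-- A Kripke frame: a nonempty set with one binary relation for every index in `A`. -/
structure Frame (A : Type) : Type 1 where
  World : Type
  nonempty : Nonempty World
  rel : A → World → World → Prop

/-- A Kripke model: a frame together with a valuation. -/
structure Model (A : Type) : Type 1 where
  frame : Frame A
  val : ℕ → Set frame.World

/-- Truth of a formula at a point of a model. -/
def Model.Sat {A : Type} (M : Model A) : M.frame.World → Form A → Prop
  | _, .bot => False
  | x, .var p => x ∈ M.val p
  | x, .imp φ ψ => M.Sat x φ → M.Sat x ψ
  | x, .box e φ => ∀ y, M.frame.rel e x y → M.Sat y φ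

/-- Validity of a formula on a frame: truth at every point of every model on the frame. -/
def Frame.Valid {A : Type} (F : Frame A) (φ : Form A) : Prop :=
  ∀ (V : ℕ → Set F.World) (x : F.World), (Model.mk F V).Sat x φ

/-! ### Normal modal logics -/

/-- A normal modal logic over the alphabet `A`. -/
structure ModalLogic (A : Type) : Type where
  thms : Set (Form A)
  taut : ∀ φ : Form A, φ.IsTautology → φ ∈ thms
  axK : ∀ e : A, Form.imp (.box e (.imp (.var 0) (.var 1)))
    (.imp (.box e (.var 0)) (.box e (.var 1))) ∈ thms
  mp : ∀ φ ψ : Form A, Form.imp φ ψ ∈ thms → φ ∈ thms → ψ ∈ thms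
  subst : ∀ (σ : ℕ → Form A) (φ : Form A), φ ∈ thms → φ.subst σ ∈ thms
  nec : ∀ (e : A) (φ : Form A), φ ∈ thms → Form.box e φ ∈ thms

namespace ModalLogic

variable {A : Type}

/-- The smallest normal modal logic containing a given set of formulas. -/
def generate (S : Set (Form A)) : ModalLogic A where
  thms := {φ | ∀ L : ModalLogic A, S ⊆ L.thms → φ ∈ L.thms}
  taut φ h L _ := L.taut φ h
  axK e L _ := L.axK e
  mp φ ψ h₁ h₂ L hL := L.mp φ ψ (h₁ L hL) (h₂ L hL)
  subst σ φ h L hL := L.subst σ φ (h L hL)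
  nec e φ h L hL := L.nec e φ (h L hL)

theorem subset_generate (S : Set (Form A)) : S ⊆ (generate S).thms :=
  fun _ hφ _ hL => hL hφ

theorem generate_subset {S : Set (Form A)} {L : ModalLogic A} (h : S ⊆ L.thms) :
    (generate S).thms ⊆ L.thms :=
  fun _ hφ => hφ L h

/-- `Fr(L)`: the class of all frames on which every formula of `L` is valid. -/
def frames (L : ModalLogic A) : Set (Frame A) :=
  {F | ∀ φ ∈ L.thms, F.Valid φ}

/-- The finite model property: `L` is the logic of some class of finite frames. -/
def HasFMP (L : ModalLogic A) : Prop :=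
  ∃ C : Set (Frame A), (∀ F ∈ C, Finite F.World) ∧
    L.thms = {φ | ∀ F ∈ C, F.Valid φ}

/-- The points of the canonical frame of `L`: the consistent complete theories containing `L`. -/
structure CanonicalWorld (L : ModalLogic A) : Type where
  theory : Set (Form A)
  contains : L.thms ⊆ theory
  mp : ∀ φ ψ : Form A, Form.imp φ ψ ∈ theory → φ ∈ theory → ψ ∈ theory
  consistent : ∀ φ : Form A, ¬ (φ ∈ theory ∧ φ.neg ∈ theory)
  complete : ∀ φ : Form A, φ ∈ theory ∨ φ.neg ∈ theory

/-- The canonical frame of `L`: `x R_e y` iff `□_e φ ∈ x` implies `φ ∈ y` for all `φ`. -/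
def canonicalFrame (L : ModalLogic A) (h : Nonempty L.CanonicalWorld) : Frame A where
  World := L.CanonicalWorld
  nonempty := h
  rel e x y := ∀ φ : Form A, Form.box e φ ∈ x.theory → φ ∈ y.theory

/-- `L` is canonical if it is valid on its canonical frame. The inconsistent logic is the only one
without canonical worlds; it has no canonical frame and counts as canonical. -/
def IsCanonical (L : ModalLogic A) : Prop :=
  ∀ h : Nonempty L.CanonicalWorld, L.canonicalFrame h ∈ L.frames

end ModalLogic

/-! ### Filtrations -/

/-- The equivalence relation on the points of `M` induced by a set of formulas `Γ`:
`x ∼_Γ y` iff the same formulas of `Γ` are true at `x` and at `y`. -/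
def Model.inducedSetoid {A : Type} (M : Model A) (Γ : Set (Form A)) : Setoid M.frame.World where
  r x y := ∀ φ ∈ Γ, M.Sat x φ ↔ M.Sat y φ
  iseqv :=
    ⟨fun _ _ _ => Iff.rfl, fun h φ hφ => (h φ hφ).symm,
      fun h₁ h₂ φ hφ => (h₁ φ hφ).trans (h₂ φ hφ)⟩

/-- The minimal filtered relation for the index `e` on the quotient by `s`. -/
def Model.minRel {A : Type} (M : Model A) (s : Setoid M.frame.World) (e : A)
    (a b : Quotient s) : Prop :=
  ∃ x y, Quotient.mk s x = a ∧ Quotient.mk s y = b ∧ M.frame.rel e x y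

/-- The maximal filtered relation for the index `e` induced by `Γ` on the quotient by `s`. -/
def Model.maxRel {A : Type} (M : Model A) (Γ : Set (Form A)) (s : Setoid M.frame.World) (e : A)
    (a b : Quotient s) : Prop :=
  ∀ x y, Quotient.mk s x = a → Quotient.mk s y = b →
    ∀ φ : Form A, Form.box e φ ∈ Γ → M.Sat x (.box e φ) → M.Sat y φ

/-- A `Γ`-filtration of the model `M`: a model on the quotient of `M` by an equivalence relation of
finite index respecting `Γ`. -/
structure Filtration {A : Type} (M : Model A) (Γ : Set (Form A)) : Type where
  equiv : Setoid M.frame.World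
  finite_index : Finite (Quotient equiv)
  respects : ∀ x y, equiv x y → M.inducedSetoid Γ x y
  rel : A → Quotient equiv → Quotient equiv → Prop
  val : ℕ → Set (Quotient equiv)
  val_iff : ∀ p : ℕ, Form.var p ∈ Γ →
    ∀ x : M.frame.World, Quotient.mk equiv x ∈ val p ↔ x ∈ M.val p
  min_le : ∀ e a b, M.minRel equiv e a b → rel e a b
  le_max : ∀ e a b, rel e a b → M.maxRel Γ equiv e a b

namespace Filtration

variable {A : Type} {M : Model A} {Γ : Set (Form A)}

/-- The underlying frame of a filtration. -/
def frame (f : Filtration M Γ) : Frame A where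
  World := Quotient f.equiv
  nonempty := M.frame.nonempty.map (Quotient.mk f.equiv)
  rel := f.rel

/-- A filtration is strict if its equivalence relation is the one induced by `Γ`. -/
def IsStrict (f : Filtration M Γ) : Prop := f.equiv = M.inducedSetoid Γ

end Filtration

/-- A class of frames admits strict filtration if for every finite `Sub`-closed set `Γ` of formulas,
every model on a frame of the class has a strict `Γ`-filtration on a frame of the class. -/
def AdmitsStrictFiltration {A : Type} (C : Set (Frame A)) : Prop :=
  ∀ Γ : Set (Form A), Γ.Finite → SubClosed Γ →
    ∀ M : Model A, M.frame ∈ C → ∃ f : Filtration M Γ, f.IsStrict ∧ f.frame ∈ C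

/-! ### Fusions and PDL-like expansions -/

/-- The fusion of a family of logics, over the disjoint union of their alphabets: the smallest
normal logic containing all of them. -/
def fusion {I : Type} {A : I → Type} (L : ∀ i, ModalLogic (A i)) : ModalLogic (Σ i, A i) :=
  ModalLogic.generate (⋃ i, Form.rename (Sigma.mk i) '' (L i).thms)

/-- The alphabet `A♯`: the symbols of `A` together with new symbols `e ∘ c`, `e ∪ c` and `e⁺`
for all `e, c` in `A`. -/
inductive Sharp (A : Type) : Type where
  | base : A → Sharp A
  | comp : A → A → Sharp A
  | union : A → A → Sharp A
  | plus : A → Sharp A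

/-- The PDL-like axioms over the alphabet `A♯`. -/
inductive PDLAxiom {A : Type} : Form (Sharp A) → Prop where
  | union (e c : A) : PDLAxiom (.iff (.box (.union e c) (.var 0))
      (.and (.box (.base e) (.var 0)) (.box (.base c) (.var 0))))
  | comp (e c : A) : PDLAxiom (.iff (.box (.comp e c) (.var 0))
      (.box (.base e) (.box (.base c) (.var 0))))
  | plus_one (e : A) : PDLAxiom (.imp (.box (.plus e) (.var 0)) (.box (.base e) (.var 0)))
  | plus_step (e : A) : PDLAxiom (.imp (.box (.plus e) (.var 0))
      (.box (.base e) (.box (.plus e) (.var 0))))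
  | plus_ind (e : A) : PDLAxiom (.imp (.box (.plus e) (.imp (.var 0) (.box (.base e) (.var 0))))
      (.imp (.box (.base e) (.var 0)) (.box (.plus e) (.var 0))))

/-- The logic `L♯`: the smallest normal logic over `A♯` containing `L` and the PDL-like axioms. -/
def ModalLogic.sharp {A : Type} (L : ModalLogic A) : ModalLogic (Sharp A) :=
  ModalLogic.generate (Form.rename Sharp.base '' L.thms ∪ {φ | PDLAxiom φ})

/-- The iterated alphabets: `A^(0) = A` and `A^(n+1) = (A^(n))♯`. -/
def SharpIter (A : Type) : ℕ → Type
  | 0 => A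
  | n + 1 => Sharp (SharpIter A n)

/-- The iterated expansions: `L^(0) = L` and `L^(n+1) = (L^(n))♯`. -/
def ModalLogic.sharpIter {A : Type} (L : ModalLogic A) : (n : ℕ) → ModalLogic (SharpIter A n)
  | 0 => L
  | n + 1 => (L.sharpIter n).sharp

end ModalPDL

/-! A non-theorem of the expanded logic fails in its canonical model, and this model is collapsed to
a finite one by filtration. The canonical frame of an expanded logic need not interpret `e⁺` as a
transitive closure, so it need not be a frame of that logic. Two weaker facts suffice: the canonical
model makes all theorems true, and its reduct to the original modalities is a frame of the fusion.
The second fact comes from canonicity of the components (`IsCanonical.reduct_mem_frames`).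

The property that survives iteration is `AdmitsDefinableFiltration`: a model of the logic with a
suitable base reduct has a filtration on a frame of the logic, with an equivalence given by finitely
many formulas. For the fusion, strict filtrations of the components share one quotient, so their
relations can be put together (`fusion_admitsDefinableFiltration`). For `♯`, the base reduct is
filtrated through a larger finite set, and the new symbols get their standard meaning on the
quotient (`AdmitsDefinableFiltration.sharp`). Unions of classes are definable, so the induction
axiom applies to them and bounds the old relation of `e⁺` by the new transitive closure.

Passing between alphabets relies on one device: a formula over a larger alphabet is a formula over
the smaller one once boxes with foreign indices count as letters. -/

namespace ModalPDL

/-! ### Translations between alphabets -/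

namespace Form

variable {A B : Type}

/-- Rename the modalities along `f`, then substitute `g p` for the letter `p`. -/
def translate (f : A → B) (g : ℕ → Form B) (φ : Form A) : Form B := (φ.rename f).subst g

/-- The formulas over `B` that act as letters when only the modalities in the range of `f` are
considered. -/
def atoms (f : A → B) : Set (Form B) :=
  {φ | (∃ p, φ = var p) ∨ ∃ b χ, b ∉ Set.range f ∧ φ = box b χ}

theorem mem_subformulas_self (φ : Form A) : φ ∈ φ.subformulas := by
  cases φ <;> simp [subformulas]

theorem subformulas_finite (φ : Form A) : φ.subformulas.Finite := by
  induction φ with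
  | bot => exact Set.finite_singleton _
  | var p => exact Set.finite_singleton _
  | imp φ ψ h₁ h₂ => exact (Set.finite_singleton _).union (h₁.union h₂)
  | box e φ h => exact (Set.finite_singleton _).union h

theorem subClosed_subformulas (φ : Form A) : SubClosed φ.subformulas := by
  induction φ with
  | bot => rintro _ rfl; exact subset_rfl
  | var p => rintro _ rfl; exact subset_rfl
  | imp φ ψ h₁ h₂ =>
    rintro χ (rfl | h | h)
    · exact subset_rfl
    · exact (h₁ χ h).trans (Set.subset_union_left.trans Set.subset_union_right)
    · exact (h₂ χ h).trans (Set.subset_union_right.trans Set.subset_union_right)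
  | box e φ ih =>
    rintro χ (rfl | h)
    · exact subset_rfl
    · exact (ih χ h).trans Set.subset_union_right

theorem translate_mem_subformulas (f : A → B) (g : ℕ → Form B) {φ χ : Form A}
    (h : χ ∈ φ.subformulas) : χ.translate f g ∈ (φ.translate f g).subformulas := by
  induction φ with
  | bot => obtain rfl := h; exact mem_subformulas_self _
  | var p => obtain rfl := h; exact mem_subformulas_self _
  | imp φ ψ h₁ h₂ =>
    rcases h with rfl | h | h
    · exact mem_subformulas_self _
    · exact Or.inr (Or.inl (h₁ h))
    · exact Or.inr (Or.inr (h₂ h))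
  | box e φ ih =>
    rcases h with rfl | h
    · exact mem_subformulas_self _
    · exact Or.inr (ih h)

/-- Every formula over `B` is built from atoms by `⊥`, `→` and the boxes indexed by the range of
`f`. -/
theorem translate_surjective {f : A → B} {g : ℕ → Form B} (hg : atoms f ⊆ Set.range g) :
    Function.Surjective (translate f g) := by
  intro φ
  induction φ with
  | bot => exact ⟨bot, rfl⟩
  | var p =>
    obtain ⟨m, hm⟩ := hg (Or.inl ⟨p, rfl⟩)
    exact ⟨var m, hm⟩
  | imp φ ψ h₁ h₂ =>
    obtain ⟨α, rfl⟩ := h₁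
    obtain ⟨β, rfl⟩ := h₂
    exact ⟨imp α β, rfl⟩
  | box e φ h =>
    by_cases he : e ∈ Set.range f
    · obtain ⟨a, rfl⟩ := he
      obtain ⟨α, rfl⟩ := h
      exact ⟨box a α, rfl⟩
    · obtain ⟨m, hm⟩ := hg (Or.inr ⟨e, φ, he, rfl⟩)
      exact ⟨var m, hm⟩

/-- Unique readability: an atom is never `⊥`, an implication, or a box with index in the range of
`f`. -/
theorem translate_injective {f : A → B} {g : ℕ → Form B} (hf : Function.Injective f)
    (hg : Function.Injective g) (hgf : ∀ m, g m ∈ atoms f) :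
    Function.Injective (translate f g) := by
  intro φ
  induction φ with
  | bot =>
    intro ψ h
    cases ψ with
    | var m =>
      have h : bot = g m := h
      rcases hgf m with ⟨p, hp⟩ | ⟨b, χ, -, hp⟩ <;> simp [hp] at h
    | _ => first | rfl | exact Form.noConfusion rfl (heq_of_eq h)
  | var m =>
    intro ψ h
    have h : g m = translate f g ψ := h
    cases ψ with
    | var m' => rw [hg h]
    | bot =>
      have h : g m = bot := h
      rcases hgf m with ⟨p, hp⟩ | ⟨b, χ, -, hp⟩ <;> simp [hp] at h
    | imp α β =>
      have h : g m = imp (α.translate f g) (β.translate f g) := h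
      rcases hgf m with ⟨p, hp⟩ | ⟨b, χ, -, hp⟩ <;> simp [hp] at h
    | box e α =>
      have h : g m = box (f e) (α.translate f g) := h
      rcases hgf m with ⟨p, hp⟩ | ⟨b, χ, hb, hp⟩ <;> simp only [hp, box.injEq, reduceCtorEq] at h
      exact absurd ⟨e, h.1.symm⟩ hb
  | imp φ₁ φ₂ h₁ h₂ =>
    intro ψ h
    have h : imp (φ₁.translate f g) (φ₂.translate f g) = translate f g ψ := h
    cases ψ with
    | bot => exact Form.noConfusion rfl (heq_of_eq h)
    | var m =>
      have h : imp (φ₁.translate f g) (φ₂.translate f g) = g m := h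
      rcases hgf m with ⟨p, hp⟩ | ⟨b, χ, -, hp⟩ <;> simp [hp] at h
    | imp α β =>
      obtain ⟨e₁, e₂⟩ := imp.inj h
      rw [h₁ e₁, h₂ e₂]
    | box e α => exact Form.noConfusion rfl (heq_of_eq h)
  | box e φ ih =>
    intro ψ h
    have h : box (f e) (φ.translate f g) = translate f g ψ := h
    cases ψ with
    | bot => exact Form.noConfusion rfl (heq_of_eq h)
    | var m =>
      have h : box (f e) (φ.translate f g) = g m := h
      rcases hgf m with ⟨p, hp⟩ | ⟨b, χ, hb, hp⟩ <;> simp only [hp, box.injEq, reduceCtorEq] at h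
      exact absurd ⟨e, h.1⟩ hb
    | imp α β => exact Form.noConfusion rfl (heq_of_eq h)
    | box e' α =>
      obtain ⟨e₁, e₂⟩ := box.inj h
      rw [hf e₁, ih e₂]

/-! ### Countability of the set of formulas -/

/-- The nesting depth of connectives in a formula. -/
def height : Form A → ℕ
  | bot => 0
  | var _ => 0
  | imp φ ψ => max φ.height ψ.height + 1
  | box _ φ => φ.height + 1

instance [Countable A] : Countable (Form A) := by
  have key : ∀ n, {φ : Form A | φ.height < n}.Countable := by
    intro n
    induction n with
    | zero => simp
    | succ n ih =>
      have h₁ := (Set.countable_range (var : ℕ → Form A)).insert bot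
      have h₂ := ih.image2 ih imp
      have h₃ := (Set.countable_univ (α := A)).image2 ih box
      refine (h₁.union (h₂.union h₃)).mono ?_
      intro φ hφ
      cases φ with
      | bot => exact Or.inl (Or.inl rfl)
      | var p => exact Or.inl (Or.inr ⟨p, rfl⟩)
      | imp φ ψ =>
        have h : max φ.height ψ.height + 1 < n + 1 := hφ
        exact Or.inr (Or.inl ⟨φ, by simp; omega, ψ, by simp; omega, rfl⟩)
      | box e φ =>
        have h : φ.height + 1 < n + 1 := hφ
        exact Or.inr (Or.inr ⟨e, trivial, φ, by simp; omega, rfl⟩)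
  refine Set.countable_univ_iff.1 ((Set.countable_iUnion key).mono ?_)
  intro φ _
  exact Set.mem_iUnion.2 ⟨φ.height + 1, Nat.lt_succ_self _⟩

/-- Over a countable alphabet, the formulas over `B` can be read as formulas over `A`. -/
theorem exists_translate_bijective [Countable B] {f : A → B} (hf : Function.Injective f) :
    ∃ g : ℕ → Form B, Function.Bijective (translate f g) := by
  -- The letters alone make the atoms infinite, so the atoms can be enumerated bijectively by `ℕ`.
  have : Infinite (atoms f) :=
    Infinite.of_injective (fun p : ℕ => (⟨var p, Or.inl ⟨p, rfl⟩⟩ : atoms f))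
      fun p q h => var.inj (congrArg Subtype.val h)
  obtain ⟨E⟩ := nonempty_equiv_of_countable (α := ℕ) (β := atoms f)
  refine ⟨fun m => E m, translate_injective hf (Subtype.val_injective.comp E.injective)
    (fun m => (E m).2), translate_surjective fun φ hφ => ⟨E.symm ⟨φ, hφ⟩, by simp⟩⟩

end Form

theorem SubClosed.preimage_translate {A B : Type} (f : A → B) (g : ℕ → Form B)
    {Γ : Set (Form B)} (h : SubClosed Γ) : SubClosed (Form.translate f g ⁻¹' Γ) :=
  fun φ hφ _ hχ => h (φ.translate f g) hφ (Form.translate_mem_subformulas f g hχ)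

theorem exists_subClosed_finite_superset {A : Type} {Γ : Set (Form A)} (h : Γ.Finite) :
    ∃ Δ : Set (Form A), Δ.Finite ∧ SubClosed Δ ∧ Γ ⊆ Δ := by
  refine ⟨⋃ φ ∈ Γ, φ.subformulas, h.biUnion fun φ _ => φ.subformulas_finite, ?_,
    fun φ hφ => Set.mem_biUnion hφ φ.mem_subformulas_self⟩
  intro χ hχ
  obtain ⟨φ, hφ, hχ⟩ := Set.mem_iUnion₂.1 hχ
  exact (φ.subClosed_subformulas χ hχ).trans (Set.subset_biUnion_of_mem (u := Form.subformulas) hφ)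

/-! ### Truth and validity -/

section Semantics

variable {A B : Type}

theorem Model.sat_and (M : Model A) (x : M.frame.World) (φ ψ : Form A) :
    M.Sat x (.and φ ψ) ↔ M.Sat x φ ∧ M.Sat x ψ := by
  simp only [Form.and, Form.neg, Model.Sat]
  tauto

theorem Model.sat_iff (M : Model A) (x : M.frame.World) (φ ψ : Form A) :
    M.Sat x (.iff φ ψ) ↔ (M.Sat x φ ↔ M.Sat x ψ) := by
  rw [Form.iff, Model.sat_and]
  exact ⟨fun h => ⟨h.1, h.2⟩, fun h => ⟨h.1, h.2⟩⟩

theorem Model.sat_subst (M : Model A) (σ : ℕ → Form A) (φ : Form A) (x : M.frame.World) :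
    M.Sat x (φ.subst σ) ↔ (Model.mk M.frame fun p => {y | M.Sat y (σ p)}).Sat x φ := by
  induction φ generalizing x with
  | bot => exact Iff.rfl
  | var p => exact Iff.rfl
  | imp φ ψ h₁ h₂ => exact imp_congr (h₁ x) (h₂ x)
  | box e φ h => exact forall₂_congr fun y _ => h y

/-- The frame over `A` obtained from a frame over `B` by reading its relations along `f`. -/
def Frame.reduct (f : A → B) (F : Frame B) : Frame A where
  World := F.World
  nonempty := F.nonempty
  rel a := F.rel (f a)

/-- The model over `A` on the reduct of `M` along `f` in which the letter `p` is interpreted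
as `g p`. -/
def Model.pullback (f : A → B) (g : ℕ → Form B) (M : Model B) : Model A where
  frame := M.frame.reduct f
  val p := {x | M.Sat x (g p)}

theorem Model.sat_pullback (f : A → B) (g : ℕ → Form B) (M : Model B) (φ : Form A)
    (x : M.frame.World) : (M.pullback f g).Sat x φ ↔ M.Sat x (φ.translate f g) := by
  induction φ generalizing x with
  | bot => exact Iff.rfl
  | var p => exact Iff.rfl
  | imp φ ψ h₁ h₂ => exact imp_congr (h₁ x) (h₂ x)
  | box e φ h => exact forall₂_congr fun y _ => h y

theorem Model.sat_rename (f : A → B) (M : Model B) (φ : Form A) (x : M.frame.World) :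
    M.Sat x (φ.rename f) ↔ (Model.mk (M.frame.reduct f) M.val).Sat x φ := by
  induction φ generalizing x with
  | bot => exact Iff.rfl
  | var p => exact Iff.rfl
  | imp φ ψ h₁ h₂ => exact imp_congr (h₁ x) (h₂ x)
  | box e φ h => exact forall₂_congr fun y _ => h y

theorem Frame.valid_rename (f : A → B) (F : Frame B) (φ : Form A) :
    F.Valid (φ.rename f) ↔ (F.reduct f).Valid φ :=
  forall₂_congr fun V x => Model.sat_rename f ⟨F, V⟩ φ x

/-- The logic of a frame. -/
def Frame.logic (F : Frame A) : ModalLogic A where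
  thms := {φ | F.Valid φ}
  taut _ h V x := h ((Model.mk F V).Sat x) id fun _ _ => Iff.rfl
  axK _ _ _ h₁ h₂ y hy := h₁ y hy (h₂ y hy)
  mp _ _ h₁ h₂ V x := h₁ V x (h₂ V x)
  subst σ φ h V x := (Model.sat_subst ⟨F, V⟩ σ φ x).2 (h _ x)
  nec _ _ h V _ y _ := h V y

/-- The formulas valid on a frame form a normal logic, so only generators need checking. -/
theorem ModalLogic.mem_frames_generate {S : Set (Form A)} {F : Frame A} :
    F ∈ (ModalLogic.generate S).frames ↔ ∀ φ ∈ S, F.Valid φ :=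
  ⟨fun h φ hφ => h φ (ModalLogic.subset_generate S hφ),
    fun h _ hφ => ModalLogic.generate_subset (L := F.logic) h hφ⟩

theorem mem_frames_fusion {I : Type} {A : I → Type} (L : ∀ i, ModalLogic (A i))
    (F : Frame (Σ i, A i)) :
    F ∈ (fusion L).frames ↔ ∀ i, F.reduct (Sigma.mk i) ∈ (L i).frames := by
  rw [fusion, ModalLogic.mem_frames_generate]
  constructor
  · intro h i φ hφ
    exact (Frame.valid_rename _ F φ).1 (h _ (Set.mem_iUnion.2 ⟨i, φ, hφ, rfl⟩))
  · intro h φ hφ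
    obtain ⟨i, ψ, hψ, rfl⟩ := Set.mem_iUnion.1 hφ
    exact (Frame.valid_rename _ F ψ).2 (h i ψ hψ)

end Semantics

/-! ### Canonical models -/

namespace ModalLogic

variable {A B : Type}

/-- Lindenbaum's lemma: a theory maximal among those omitting `φ` is complete. -/
theorem exists_canonicalWorld (L : ModalLogic A) {T : Set (Form A)} (hL : L.thms ⊆ T)
    (hmp : ∀ φ ψ : Form A, Form.imp φ ψ ∈ T → φ ∈ T → ψ ∈ T) {φ : Form A} (hφ : φ ∉ T) :
    ∃ x : L.CanonicalWorld, T ⊆ x.theory ∧ φ ∉ x.theory := by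
  obtain ⟨m, hTm, hm⟩ := zorn_subset_nonempty
    {S : Set (Form A) | L.thms ⊆ S ∧ (∀ α β : Form A, Form.imp α β ∈ S → α ∈ S → β ∈ S) ∧ φ ∉ S}
    (fun c hc hchain hne => by
      obtain ⟨s₀, hs₀⟩ := hne
      refine ⟨⋃₀ c, ⟨(hc hs₀).1.trans (Set.subset_sUnion_of_mem hs₀), ?_, ?_⟩,
        fun s hs => Set.subset_sUnion_of_mem hs⟩
      · rintro α β ⟨s, hs, h₁⟩ ⟨t, ht, h₂⟩
        rcases hchain.total hs ht with hst | hts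
        · exact ⟨t, ht, (hc ht).2.1 α β (hst h₁) h₂⟩
        · exact ⟨s, hs, (hc hs).2.1 α β h₁ (hts h₂)⟩
      · rintro ⟨s, hs, h⟩
        exact (hc hs).2.2 h) T ⟨hL, hmp, hφ⟩
  obtain ⟨⟨hLm, hmpm, hφm⟩, hmax⟩ := hm
  have taut : ∀ α : Form A, α.IsTautology → α ∈ m := fun α h => hLm (L.taut α h)
  -- The set of `ψ` with `χ → ψ ∈ m` is a theory extending `m` and containing `χ`; if it omitted
  -- `φ`, maximality would put `χ` in `m`.
  have key : ∀ χ : Form A, χ ∉ m → Form.imp χ φ ∈ m := by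
    intro χ hχ
    by_contra hcon
    have hsub : m ⊆ {ψ | Form.imp χ ψ ∈ m} := fun ψ hψ =>
      hmpm ψ _ (taut _ fun v _ hi => by simp only [hi]; tauto) hψ
    refine hχ (hmax ⟨hLm.trans hsub, ?_, hcon⟩ hsub ?_)
    · intro α β h₁ h₂
      exact hmpm _ _ (hmpm _ _ (taut (.imp (.imp χ (.imp α β)) (.imp (.imp χ α) (.imp χ β)))
        fun v _ hi => by simp only [hi]; tauto) h₁) h₂
    · exact taut _ fun v _ hi => by simp only [hi]; tauto
  refine ⟨⟨m, hLm, hmpm, ?_, ?_⟩, hTm, hφm⟩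
  · rintro χ ⟨h₁, h₂⟩
    exact hφm (hmpm _ _ (taut (.imp .bot φ) fun v hb hi => by simp only [hi]; tauto)
      (hmpm _ _ h₂ h₁))
  · intro χ
    by_contra! h
    exact hφm (hmpm _ _ (hmpm _ _ (taut (.imp (.imp χ φ) (.imp (.imp χ.neg φ) φ))
      fun v hb hi => by simp only [hi, Form.neg]; tauto) (key χ h.1)) (key _ h.2))

theorem CanonicalWorld.ext {L : ModalLogic A} {x y : L.CanonicalWorld}
    (h : x.theory = y.theory) : x = y := by
  cases x
  cases y
  cases h
  rfl

theorem CanonicalWorld.imp_mem {L : ModalLogic A} (x : L.CanonicalWorld) (φ ψ : Form A) :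
    Form.imp φ ψ ∈ x.theory ↔ (φ ∈ x.theory → ψ ∈ x.theory) := by
  refine ⟨x.mp φ ψ, fun h => ?_⟩
  rcases x.complete φ with hφ | hφ
  · exact x.mp ψ _ (x.contains (L.taut _ fun v _ hi => by simp only [hi]; tauto)) (h hφ)
  · exact x.mp _ _ (x.contains (L.taut (.imp φ.neg (.imp φ ψ))
      fun v hb hi => by simp only [hi, Form.neg]; tauto)) hφ

theorem CanonicalWorld.bot_notMem {L : ModalLogic A} (x : L.CanonicalWorld) :
    Form.bot ∉ x.theory := fun h =>
  x.consistent .bot ⟨h, x.contains (L.taut _ fun v _ hi => by simp only [hi, Form.neg]; tauto)⟩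

theorem box_imp_mem (L : ModalLogic A) (e : A) (φ ψ : Form A) :
    Form.imp (.box e (.imp φ ψ)) (.imp (.box e φ) (.box e ψ)) ∈ L.thms :=
  L.subst (fun p => if p = 0 then φ else ψ) _ (L.axK e)

/-- The canonical model. -/
def canonicalModel (L : ModalLogic A) (h : Nonempty L.CanonicalWorld) : Model A where
  frame := L.canonicalFrame h
  val p := {x : L.CanonicalWorld | Form.var p ∈ x.theory}

theorem sat_canonicalModel (L : ModalLogic A) (h : Nonempty L.CanonicalWorld) (φ : Form A)
    (x : L.CanonicalWorld) : (L.canonicalModel h).Sat x φ ↔ φ ∈ x.theory := by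
  induction φ generalizing x with
  | bot => exact ⟨False.elim, x.bot_notMem⟩
  | var p => exact Iff.rfl
  | imp φ ψ h₁ h₂ => exact (imp_congr (h₁ x) (h₂ x)).trans (x.imp_mem φ ψ).symm
  | box e φ ih =>
    refine ⟨fun hx => ?_, fun hx y hy => (ih y).2 (hy φ hx)⟩
    by_contra hn
    -- Necessitation and K make this set a theory containing `L`.
    obtain ⟨y, hy, hφ⟩ := L.exists_canonicalWorld (T := {ψ | Form.box e ψ ∈ x.theory})
      (fun ψ hψ => x.contains (L.nec e ψ hψ))
      (fun α β hα hβ => x.mp _ _ (x.mp _ _ (x.contains (L.box_imp_mem e α β)) hα) hβ) hn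
    exact hφ ((ih y).1 (hx y fun ψ hψ => hy hψ))

/-- If `Λ` extends a canonical logic `L` read along an embedding of alphabets, then the
corresponding reduct of the canonical frame of `Λ` is a frame of `L`. -/
theorem IsCanonical.reduct_mem_frames [Countable B] {L : ModalLogic A} (hL : L.IsCanonical)
    {Λ : ModalLogic B} {f : A → B} (hf : Function.Injective f)
    (hΛ : Form.rename f '' L.thms ⊆ Λ.thms) (h : Nonempty Λ.CanonicalWorld) :
    (Λ.canonicalFrame h).reduct f ∈ L.frames := by
  obtain ⟨g, hg⟩ := Form.exists_translate_bijective hf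
  let T : Form A ≃ Form B := Equiv.ofBijective _ hg
  have T_imp : ∀ φ ψ : Form A, T (.imp φ ψ) = .imp (T φ) (T ψ) := fun _ _ => rfl
  have T_neg : ∀ φ : Form A, T φ.neg = (T φ).neg := fun _ => rfl
  have T_box : ∀ (e : A) (φ : Form A), T (.box e φ) = .box (f e) (T φ) := fun _ _ => rfl
  have S_imp : ∀ φ ψ : Form B, T.symm (.imp φ ψ) = .imp (T.symm φ) (T.symm ψ) := fun φ ψ => by
    rw [Equiv.symm_apply_eq, T_imp, T.apply_symm_apply, T.apply_symm_apply]
  have S_neg : ∀ φ : Form B, T.symm φ.neg = (T.symm φ).neg := fun φ => by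
    rw [Equiv.symm_apply_eq, T_neg, T.apply_symm_apply]
  have S_box : ∀ (e : A) (φ : Form B), T.symm (.box (f e) φ) = .box e (T.symm φ) := fun e φ => by
    rw [Equiv.symm_apply_eq, T_box, T.apply_symm_apply]
  -- `ι` will be an isomorphism of the reduct onto a generated subframe of the canonical frame of
  -- `L`, and validity passes to generated subframes.
  let ι : Λ.CanonicalWorld → L.CanonicalWorld := fun x =>
    { theory := T ⁻¹' x.theory
      contains := fun φ hφ => x.contains (Λ.subst g _ (hΛ ⟨φ, hφ, rfl⟩))
      mp := fun φ ψ h₁ h₂ => x.mp (T φ) (T ψ) h₁ h₂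
      consistent := fun φ => x.consistent (T φ)
      complete := fun φ => x.complete (T φ) }
  have ι_inj : Function.Injective ι := fun x y hxy => by
    have h : T ⁻¹' x.theory = T ⁻¹' y.theory := congrArg CanonicalWorld.theory hxy
    exact CanonicalWorld.ext (Set.preimage_injective.2 T.surjective h)
  have h' : Nonempty L.CanonicalWorld := h.map ι
  -- The image of `ι` is closed under successors: `x` contains `□ φ` for every theorem `φ` of `Λ`,
  -- so a successor of `ι x`, read over `B`, contains `Λ`.
  have lift : ∀ (e : A) (x : Λ.CanonicalWorld) (y : L.CanonicalWorld),
      (L.canonicalFrame h').rel e (ι x) y →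
        ∃ z : Λ.CanonicalWorld, ι z = y ∧ (Λ.canonicalFrame h).rel (f e) x z := by
    intro e x y hxy
    refine ⟨⟨T.symm ⁻¹' y.theory, ?_, ?_, ?_, ?_⟩, ?_, ?_⟩
    · intro φ hφ
      refine hxy (T.symm φ) ?_
      change T (.box e (T.symm φ)) ∈ x.theory
      rw [T_box, T.apply_symm_apply]
      exact x.contains (Λ.nec _ _ hφ)
    · intro φ ψ h₁ h₂
      rw [Set.mem_preimage, S_imp] at h₁
      exact y.mp _ _ h₁ h₂
    · intro φ
      rw [Set.mem_preimage, Set.mem_preimage, S_neg]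
      exact y.consistent _
    · intro φ
      rw [Set.mem_preimage, Set.mem_preimage, S_neg]
      exact y.complete _
    · refine CanonicalWorld.ext ?_
      change T ⁻¹' (T.symm ⁻¹' y.theory) = y.theory
      rw [← Set.preimage_comp]
      simp
    · intro φ hφ
      refine hxy (T.symm φ) ?_
      change T (.box e (T.symm φ)) ∈ x.theory
      rwa [T_box, T.apply_symm_apply]
  intro φ hφ V x
  have key : ∀ (φ : Form A) (x : Λ.CanonicalWorld),
      (Model.mk ((Λ.canonicalFrame h).reduct f) V).Sat x φ ↔
        (Model.mk (L.canonicalFrame h') fun p => ι '' V p).Sat (ι x) φ := by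
    intro φ
    induction φ with
    | bot => exact fun _ => Iff.rfl
    | var p => exact fun x => (ι_inj.mem_set_image (s := V p)).symm
    | imp φ ψ h₁ h₂ => exact fun x => imp_congr (h₁ x) (h₂ x)
    | box e φ ih =>
      refine fun x => ⟨fun hx y hy => ?_, fun hx y hy => (ih y).2 (hx (ι y) fun ψ hψ => hy _ hψ)⟩
      obtain ⟨z, rfl, hz⟩ := lift e x y hy
      exact (ih z).1 (hx z hz)
  exact (key φ x).2 (hL h' φ hφ _ _)

end ModalLogic

/-! ### Filtrations -/

section Filtrations

variable {A B : Type}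

theorem Model.finite_quotient_inducedSetoid (M : Model A) {Γ : Set (Form A)} (h : Γ.Finite) :
    Finite (Quotient (M.inducedSetoid Γ)) := by
  have := h.to_subtype
  let F : Quotient (M.inducedSetoid Γ) → Set Γ := Quotient.lift (fun x => {φ : Γ | M.Sat x φ})
    fun x y hxy => Set.ext fun φ => hxy φ φ.2
  refine Finite.of_injective F ?_
  rintro ⟨x⟩ ⟨y⟩ hxy
  exact Quotient.sound fun φ hφ => Set.ext_iff.1 hxy ⟨φ, hφ⟩

theorem Model.inducedSetoid_pullback (f : A → B) (g : ℕ → Form B) (M : Model B)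
    (Γ : Set (Form A)) :
    (M.pullback f g).inducedSetoid Γ = M.inducedSetoid (Form.translate f g '' Γ) := by
  refine Setoid.ext fun x y => ⟨?_, fun h φ hφ => ?_⟩
  · rintro h _ ⟨φ, hφ, rfl⟩
    exact (M.sat_pullback f g φ x).symm.trans ((h φ hφ).trans (M.sat_pullback f g φ y))
  · exact (M.sat_pullback f g φ x).trans ((h _ ⟨φ, hφ, rfl⟩).trans (M.sat_pullback f g φ y).symm)

/-- Sets of points invariant under the equivalence induced by finitely many formulas are
definable. -/
theorem Model.exists_definable (M : Model A) {Γ : Set (Form A)} (hΓ : Γ.Finite) :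
    ∀ S : Set M.frame.World, (∀ x y, M.inducedSetoid Γ x y → x ∈ S → y ∈ S) →
      ∃ ψ : Form A, ∀ x, M.Sat x ψ ↔ x ∈ S := by
  induction Γ, hΓ using Set.Finite.induction_on with
  | empty =>
    intro S hS
    by_cases h : ∃ x, x ∈ S
    · obtain ⟨x, hx⟩ := h
      exact ⟨.imp .bot .bot, fun y => ⟨fun _ => hS x y (fun _ h => h.elim) hx, fun _ => id⟩⟩
    · exact ⟨.bot, fun y => ⟨False.elim, fun hy => h ⟨y, hy⟩⟩⟩
  | @insert φ Γ _ _ ih =>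
    intro S hS
    -- Split `S` by the truth value of `φ` and saturate each half under the equivalence of the
    -- smaller `Γ`. Both saturations are definable by induction, and each agrees with `S` on its own
    -- side of `φ`.
    have inv : ∀ P : M.frame.World → Prop, ∀ x y, M.inducedSetoid Γ x y →
        x ∈ {x | ∃ z, M.inducedSetoid Γ z x ∧ P z ∧ z ∈ S} →
        y ∈ {x | ∃ z, M.inducedSetoid Γ z x ∧ P z ∧ z ∈ S} := by
      rintro P x y hxy ⟨z, hz, h⟩
      exact ⟨z, (M.inducedSetoid Γ).trans hz hxy, h⟩
    obtain ⟨ψ₁, h₁⟩ := ih _ (inv fun z => M.Sat z φ)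
    obtain ⟨ψ₂, h₂⟩ := ih _ (inv fun z => ¬ M.Sat z φ)
    refine ⟨.and (.imp φ ψ₁) (.imp φ.neg ψ₂), fun x => ?_⟩
    have back : ∀ z, M.inducedSetoid Γ z x → (M.Sat z φ ↔ M.Sat x φ) → z ∈ S → x ∈ S :=
      fun z hz hφ => hS z x (by rintro χ (rfl | hχ); exacts [hφ, hz χ hχ])
    rw [Model.sat_and]
    change ((M.Sat x φ → M.Sat x ψ₁) ∧ ((M.Sat x φ → False) → M.Sat x ψ₂)) ↔ _
    rw [h₁, h₂]
    constructor
    · rintro ⟨k₁, k₂⟩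
      by_cases hx : M.Sat x φ
      · obtain ⟨z, hz, hzφ, hzS⟩ := k₁ hx
        exact back z hz (iff_of_true hzφ hx) hzS
      · obtain ⟨z, hz, hzφ, hzS⟩ := k₂ hx
        exact back z hz (iff_of_false hzφ hx) hzS
    · exact fun hx => ⟨fun hφ => ⟨x, fun _ _ => Iff.rfl, hφ, hx⟩,
        fun hφ => ⟨x, fun _ _ => Iff.rfl, hφ, hx⟩⟩

/-- The filtration with prescribed equivalence and relations. -/
def Filtration.ofRel {M : Model A} {Γ : Set (Form A)} (s : Setoid M.frame.World)
    (hfin : Finite (Quotient s)) (hs : ∀ x y, s x y → M.inducedSetoid Γ x y)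
    (R : A → Quotient s → Quotient s → Prop) (hmin : ∀ e a b, M.minRel s e a b → R e a b)
    (hmax : ∀ e a b, R e a b → M.maxRel Γ s e a b) : Filtration M Γ where
  equiv := s
  finite_index := hfin
  respects := hs
  rel := R
  -- The choice of representative is immaterial for letters in `Γ`; the values of other letters are
  -- free.
  val p := {a | ∃ x, Quotient.mk s x = a ∧ x ∈ M.val p}
  val_iff _ hp x :=
    ⟨fun ⟨y, hy, h⟩ => (hs y x (Quotient.exact hy) _ hp).1 h, fun h => ⟨x, rfl, h⟩⟩
  min_le := hmin
  le_max := hmax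

/-- The filtration lemma: in the box case `min_le` gives one direction and `le_max` the other. -/
theorem Filtration.sat_iff {M : Model A} {Γ : Set (Form A)} (hΓ : SubClosed Γ)
    (f : Filtration M Γ) (φ : Form A) (hφ : φ ∈ Γ) (x : M.frame.World) :
    (Model.mk f.frame f.val).Sat (Quotient.mk f.equiv x) φ ↔ M.Sat x φ := by
  induction φ generalizing x with
  | bot => exact Iff.rfl
  | var p => exact f.val_iff p hφ x
  | imp φ ψ h₁ h₂ =>
    exact imp_congr (h₁ (hΓ _ hφ (Or.inr (Or.inl φ.mem_subformulas_self))) x)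
      (h₂ (hΓ _ hφ (Or.inr (Or.inr ψ.mem_subformulas_self))) x)
  | box e φ ih =>
    have ih := ih (hΓ _ hφ (Or.inr φ.mem_subformulas_self))
    constructor
    · intro h y hy
      exact (ih y).1 (h _ (f.min_le e _ _ ⟨x, y, rfl, rfl, hy⟩))
    · intro h b hb
      obtain ⟨y, rfl⟩ := Quotient.exists_rep b
      exact (ih y).2 (f.le_max e _ _ hb x y rfl rfl φ hφ h)

/-- Strictness fixes the carrier as the quotient by `∼_Γ` itself, so that relations obtained for
different components can live on one set. -/
theorem AdmitsStrictFiltration.exists_rel {C : Set (Frame A)} (hC : AdmitsStrictFiltration C)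
    {M : Model A} (hM : M.frame ∈ C) {Γ : Set (Form A)} (hfin : Γ.Finite) (hΓ : SubClosed Γ) :
    ∃ R : A → Quotient (M.inducedSetoid Γ) → Quotient (M.inducedSetoid Γ) → Prop,
      (∀ e a b, M.minRel _ e a b → R e a b) ∧ (∀ e a b, R e a b → M.maxRel Γ _ e a b) ∧
        Frame.mk (Quotient (M.inducedSetoid Γ)) (M.frame.nonempty.map (Quotient.mk _)) R ∈ C := by
  obtain ⟨⟨s, _, _, R, _, _, hmin, hmax⟩, hs, hf⟩ := hC Γ hfin hΓ M hM
  have hs : s = M.inducedSetoid Γ := hs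
  subst hs
  exact ⟨R, hmin, hmax, hf⟩

/-- Every model of `L` on a frame from `K` has, for every finite subformula-closed set, a
filtration on a frame of `L` whose equivalence is induced by finitely many formulas. -/
def AdmitsDefinableFiltration (L : ModalLogic A) (K : Set (Frame A)) : Prop :=
  ∀ Γ : Set (Form A), Γ.Finite → SubClosed Γ → ∀ M : Model A, M.frame ∈ K →
    (∀ φ ∈ L.thms, ∀ x, M.Sat x φ) →
      ∃ f : Filtration M Γ, f.frame ∈ L.frames ∧
        ∃ Δ : Set (Form A), Δ.Finite ∧ f.equiv = M.inducedSetoid Δ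

/-- The canonical model makes `L` true by the truth lemma, so filtrating it through the subformulas
of a non-theorem yields a finite refuting frame of `L`. -/
theorem AdmitsDefinableFiltration.hasFMP {L : ModalLogic A} {K : Set (Frame A)}
    (hL : AdmitsDefinableFiltration L K) (hK : ∀ h, L.canonicalFrame h ∈ K) : L.HasFMP := by
  refine ⟨{F | Finite F.World ∧ F ∈ L.frames}, fun F hF => hF.1, ?_⟩
  refine Set.Subset.antisymm (fun φ hφ F hF => hF.2 φ hφ) fun φ hφ => ?_
  by_contra hn
  obtain ⟨x, -, hx⟩ := L.exists_canonicalWorld subset_rfl L.mp hn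
  obtain ⟨f, hf, -⟩ := hL φ.subformulas φ.subformulas_finite φ.subClosed_subformulas
    (L.canonicalModel ⟨x⟩) (hK ⟨x⟩)
    fun ψ hψ y => (L.sat_canonicalModel ⟨x⟩ ψ y).2 (ModalLogic.CanonicalWorld.contains y hψ)
  have h := hφ f.frame ⟨f.finite_index, hf⟩ f.val (Quotient.mk f.equiv x)
  exact hx ((L.sat_canonicalModel ⟨x⟩ φ x).1
    ((f.sat_iff φ.subClosed_subformulas φ φ.mem_subformulas_self x).1 h))

theorem fusion_admitsDefinableFiltration {I : Type} {A : I → Type} [Countable (Σ i, A i)]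
    (L : ∀ i, ModalLogic (A i)) (hL : ∀ i, AdmitsStrictFiltration (L i).frames) :
    AdmitsDefinableFiltration (fusion L) (fusion L).frames := by
  intro Γ hfin hΓ M hM _
  rw [mem_frames_fusion] at hM
  have key : ∀ i, ∃ R : A i → Quotient (M.inducedSetoid Γ) → Quotient (M.inducedSetoid Γ) → Prop,
      (∀ e a b, M.minRel _ ⟨i, e⟩ a b → R e a b) ∧
      (∀ e a b, R e a b → M.maxRel Γ _ ⟨i, e⟩ a b) ∧
        Frame.mk (Quotient (M.inducedSetoid Γ)) (M.frame.nonempty.map (Quotient.mk _)) R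
          ∈ (L i).frames := by
    intro i
    obtain ⟨g, hg⟩ := Form.exists_translate_bijective (sigma_mk_injective (β := A) (i := i))
    have h := (hL i).exists_rel (M := M.pullback (Sigma.mk i) g) (hM i)
      (hfin.preimage hg.1.injOn) (hΓ.preimage_translate (Sigma.mk i) g)
    -- Since every formula is a translation, the `i`-th reading of `Γ` induces exactly `∼_Γ`, the
    -- same equivalence for all `i`.
    rw [M.inducedSetoid_pullback, Set.image_preimage_eq _ hg.2] at h
    obtain ⟨R, hmin, hmax, hR⟩ := h
    refine ⟨R, hmin, fun e a b hab x y hx hy φ hφ hbox => ?_, hR⟩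
    obtain ⟨ψ, rfl⟩ := hg.2 φ
    exact (M.sat_pullback _ g ψ y).1 (hmax e a b hab x y hx hy ψ hφ
      ((M.sat_pullback _ g (.box e ψ) x).2 hbox))
  choose R hmin hmax hR using key
  refine ⟨.ofRel (M.inducedSetoid Γ) (M.finite_quotient_inducedSetoid hfin) (fun _ _ h => h)
    (fun e => R e.1 e.2) (fun e => hmin e.1 e.2) (fun e => hmax e.1 e.2), ?_, Γ, hfin, rfl⟩
  exact (mem_frames_fusion L _).2 hR

end Filtrations

/-! ### PDL-like expansions -/

section PDL

variable {A : Type}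

theorem Sharp.base_injective : Function.Injective (Sharp.base : A → Sharp A) :=
  fun _ _ h => Sharp.base.inj h

instance [Countable A] : Countable (Sharp A) := by
  let F : Sharp A → (A ⊕ A × A) ⊕ (A × A ⊕ A)
    | .base e => .inl (.inl e)
    | .comp e c => .inl (.inr (e, c))
    | .union e c => .inr (.inl (e, c))
    | .plus e => .inr (.inr e)
  refine Function.Injective.countable (f := F) ?_
  rintro (_ | _ | _ | _) (_ | _ | _ | _) h <;> simp_all [F]

/-- The standard interpretation of the symbols of `A♯`. -/
def sharpRel {W : Type} (R : A → W → W → Prop) : Sharp A → W → W → Prop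
  | .base e => R e
  | .comp e c => Relation.Comp (R e) (R c)
  | .union e c => fun x y => R e x y ∨ R c x y
  | .plus e => Relation.TransGen (R e)

theorem PDLAxiom.valid {W : Type} (hW : Nonempty W) (R : A → W → W → Prop)
    {φ : Form (Sharp A)} (h : PDLAxiom φ) : (Frame.mk W hW (sharpRel R)).Valid φ := by
  intro V x
  cases h with
  | union e c =>
    rw [Model.sat_iff, Model.sat_and]
    exact ⟨fun h => ⟨fun y hy => h y (Or.inl hy), fun y hy => h y (Or.inr hy)⟩,
      fun h y hy => hy.elim (h.1 y) (h.2 y)⟩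
  | comp e c =>
    rw [Model.sat_iff]
    exact ⟨fun h z hz y hy => h y ⟨z, hz, hy⟩, fun h y ⟨z, hz, hy⟩ => h z hz y hy⟩
  | plus_one e => exact fun h y hy => h y (.single hy)
  | plus_step e => exact fun h z hz y hy => h y (.head hz hy)
  | plus_ind e =>
    intro h₁ h₂ y hy
    induction hy with
    | single hy => exact h₂ _ hy
    | tail hy hz ih => exact h₁ _ hy ih _ hz

theorem mem_frames_sharp {L : ModalLogic A} {W : Type} {hW : Nonempty W} {R : A → W → W → Prop}
    (hL : Frame.mk W hW R ∈ L.frames) : Frame.mk W hW (sharpRel R) ∈ L.sharp.frames := by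
  refine ModalLogic.mem_frames_generate.2 ?_
  rintro φ (⟨ψ, hψ, rfl⟩ | hφ)
  · exact (Frame.valid_rename _ _ ψ).2 (hL ψ hψ)
  · exact PDLAxiom.valid hW R hφ

theorem ModalLogic.rename_mem_sharp (L : ModalLogic A) {φ : Form A} (h : φ ∈ L.thms) :
    φ.rename Sharp.base ∈ L.sharp.thms :=
  ModalLogic.subset_generate _ (Or.inl ⟨φ, h, rfl⟩)

/-- Truth in a model of the substitution instances of the PDL-like axioms. -/
structure Model.IsPDL (M : Model (Sharp A)) : Prop where
  union : ∀ e c φ x, M.Sat x (.box (.union e c) φ) ↔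
    M.Sat x (.box (.base e) φ) ∧ M.Sat x (.box (.base c) φ)
  comp : ∀ e c φ x, M.Sat x (.box (.comp e c) φ) ↔ M.Sat x (.box (.base e) (.box (.base c) φ))
  plus_one : ∀ e φ x, M.Sat x (.box (.plus e) φ) → M.Sat x (.box (.base e) φ)
  plus_step : ∀ e φ x, M.Sat x (.box (.plus e) φ) → M.Sat x (.box (.base e) (.box (.plus e) φ))
  plus_ind : ∀ e φ x, M.Sat x (.box (.plus e) (.imp φ (.box (.base e) φ))) →
    M.Sat x (.box (.base e) φ) → M.Sat x (.box (.plus e) φ)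

theorem Model.isPDL_of_sharp {L : ModalLogic A} {M : Model (Sharp A)}
    (hM : ∀ φ ∈ L.sharp.thms, ∀ x, M.Sat x φ) : M.IsPDL := by
  -- The axioms contain only the letter `0`, so a constant substitution is enough.
  have key : ∀ {χ : Form (Sharp A)}, PDLAxiom χ → ∀ φ x, M.Sat x (χ.subst fun _ => φ) :=
    fun h φ => hM _ (L.sharp.subst _ _ (ModalLogic.subset_generate _ (Or.inr h)))
  refine ⟨fun e c φ x => ?_, fun e c φ x => ?_, fun e φ x => key (.plus_one e) φ x,
    fun e φ x => key (.plus_step e) φ x, fun e φ x => key (.plus_ind e) φ x⟩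
  · rw [← Model.sat_and, ← Model.sat_iff]
    exact key (.union e c) φ x
  · rw [← Model.sat_iff]
    exact key (.comp e c) φ x

/-- The formulas whose truth controls that of `φ` in standard models. -/
def Form.expansion : Form (Sharp A) → Set (Form (Sharp A))
  | .box (.comp e c) φ => {.box (.base e) (.box (.base c) φ)}
  | .box (.union e c) φ => {.box (.base e) φ, .box (.base c) φ}
  | .box (.plus e) φ => {.box (.base e) φ, .box (.base e) (.box (.plus e) φ)}
  | _ => ∅

theorem Form.expansion_finite (φ : Form (Sharp A)) : φ.expansion.Finite := by
  unfold Form.expansion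
  split <;> simp

/-- The relations of `M` for the new symbols are known only through the axioms. The points whose
class is standardly reachable from that of `x` form a union of classes, hence are defined by some
`ψ`, and the axioms give `□_e ψ` at `x`. -/
theorem Model.IsPDL.minRel_sharpRel {M : Model (Sharp A)} (hM : M.IsPDL)
    {Δ : Set (Form (Sharp A))} (hΔ : Δ.Finite)
    {R : A → Quotient (M.inducedSetoid Δ) → Quotient (M.inducedSetoid Δ) → Prop}
    (hR : ∀ e a b, M.minRel _ (.base e) a b → R e a b) (e : Sharp A)
    (a b : Quotient (M.inducedSetoid Δ)) (h : M.minRel _ e a b) : sharpRel R e a b := by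
  obtain ⟨x, y, rfl, rfl, hxy⟩ := h
  have step : ∀ e x y, M.frame.rel (.base e) x y →
      R e (Quotient.mk _ x) (Quotient.mk _ y) := fun e x y h => hR e _ _ ⟨x, y, rfl, rfl, h⟩
  obtain ⟨ψ, hψ⟩ := M.exists_definable hΔ
    {z | sharpRel R e (Quotient.mk (M.inducedSetoid Δ) x) (Quotient.mk (M.inducedSetoid Δ) z)}
    (fun z w hzw hz => by rwa [Set.mem_ofPred_eq, ← Quotient.sound hzw])
  refine (hψ y).1 ?_
  suffices hbox : M.Sat x (.box e ψ) from hbox y hxy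
  cases e with
  | base e => exact fun z hz => (hψ z).2 (step e x z hz)
  | comp e c =>
    rw [hM.comp]
    exact fun z hz w hw => (hψ w).2 ⟨_, step e x z hz, step c z w hw⟩
  | union e c =>
    rw [hM.union]
    exact ⟨fun z hz => (hψ z).2 (Or.inl (step e x z hz)),
      fun z hz => (hψ z).2 (Or.inr (step c x z hz))⟩
  | plus e =>
    -- Reachability is preserved by base steps, so `ψ → □_e ψ` holds at every point.
    refine hM.plus_ind e ψ x (fun z _ hz w hw => ?_) fun z hz => ?_
    · exact (hψ w).2 (Relation.TransGen.tail ((hψ z).1 hz) (step e z w hw))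
    · exact (hψ z).2 (Relation.TransGen.single (step e x z hz))

/-- The axioms turn a box with a new index into members of its expansion, which lie in `Δ` and are
therefore transmitted by the base relations. -/
theorem Model.IsPDL.sharpRel_maxRel {M : Model (Sharp A)} (hM : M.IsPDL)
    {Γ Δ : Set (Form (Sharp A))} (hΓ : Γ ⊆ Δ) (hexp : ∀ φ ∈ Γ, φ.expansion ⊆ Δ)
    {s : Setoid M.frame.World} {R : A → Quotient s → Quotient s → Prop}
    (hΔ : SubClosed Δ) (hR : ∀ e a b, R e a b → M.maxRel Δ s (.base e) a b) (e : Sharp A)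
    (a b : Quotient s) (h : sharpRel R e a b) : M.maxRel Γ s e a b := by
  rintro x y rfl rfl φ hφ hx
  have hexp := hexp _ hφ
  cases e with
  | base e => exact hR e _ _ h x y rfl rfl φ (hΓ hφ) hx
  | comp e c =>
    have hmem : Form.box (.base e) (.box (.base c) φ) ∈ Δ := hexp rfl
    obtain ⟨_, h₁, h₂⟩ := h
    obtain ⟨z, rfl⟩ := Quotient.exists_rep ‹_›
    have hz := hR e _ _ h₁ x z rfl rfl _ hmem ((hM.comp e c φ x).1 hx)
    exact hR c _ _ h₂ z y rfl rfl φ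
      (hΔ _ hmem (Or.inr (Form.mem_subformulas_self _))) hz
  | union e c =>
    obtain ⟨h₁, h₂⟩ := (hM.union e c φ x).1 hx
    rcases h with h | h
    · exact hR e _ _ h x y rfl rfl φ (hexp (Or.inl rfl)) h₁
    · exact hR c _ _ h x y rfl rfl φ (hexp (Or.inr rfl)) h₂
  | plus e =>
    -- Along a chain in the quotient, `□_{e⁺} φ` must be carried together with `φ` to allow the next
    -- step.
    have one : ∀ z w, R e (Quotient.mk s z) (Quotient.mk s w) → M.Sat z (.box (.plus e) φ) →
        M.Sat w φ ∧ M.Sat w (.box (.plus e) φ) := fun z w hzw hz =>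
      ⟨hR e _ _ hzw z w rfl rfl φ (hexp (Or.inl rfl)) (hM.plus_one e φ z hz),
        hR e _ _ hzw z w rfl rfl _ (hexp (Or.inr rfl)) (hM.plus_step e φ z hz)⟩
    have key : ∀ b, Relation.TransGen (R e) (Quotient.mk s x) b → ∀ w, Quotient.mk s w = b →
        M.Sat w φ ∧ M.Sat w (.box (.plus e) φ) := by
      intro b hb
      induction hb with
      | single hb => rintro w rfl; exact one x w hb hx
      | @tail b c _ hc ih =>
        rintro w rfl
        obtain ⟨z, rfl⟩ := Quotient.exists_rep b
        exact one z w hc (ih z rfl).2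
    exact (key _ h y rfl).1

/-- Only the base reduct has to lie in `K`; the new relations of `M` may be nonstandard, while those
of the filtration are standard by construction. -/
theorem AdmitsDefinableFiltration.sharp [Countable A] {L : ModalLogic A} {K : Set (Frame A)}
    (hL : AdmitsDefinableFiltration L K) :
    AdmitsDefinableFiltration L.sharp {F | F.reduct Sharp.base ∈ K} := by
  intro Γ hfin hΓ M hMK hM
  obtain ⟨Δ, hΔfin, hΔ, hsub⟩ := exists_subClosed_finite_superset
    (hfin.union (hfin.biUnion fun φ _ => φ.expansion_finite))
  have hΓΔ : Γ ⊆ Δ := Set.subset_union_left.trans hsub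
  have hexp : ∀ φ ∈ Γ, φ.expansion ⊆ Δ := fun φ hφ =>
    (Set.subset_biUnion_of_mem (u := Form.expansion) hφ).trans (Set.subset_union_right.trans hsub)
  obtain ⟨g, hg⟩ := Form.exists_translate_bijective (Sharp.base_injective (A := A))
  obtain ⟨f, hf, Δ', hΔ'fin, hequiv⟩ := hL _ (hΔfin.preimage hg.1.injOn)
    (hΔ.preimage_translate Sharp.base g) (M.pullback Sharp.base g) hMK fun φ hφ x =>
      (M.sat_pullback _ g φ x).2 (hM _ (L.sharp.subst g _ (L.rename_mem_sharp hφ)) x)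
  obtain ⟨s, hsfin, hs, R, _, _, hmin, hmax⟩ := f
  -- Translating `Δ'` back to `A♯` keeps the equivalence finitely definable, as the next expansion
  -- requires.
  obtain rfl : s = _ := hequiv.trans (M.inducedSetoid_pullback Sharp.base g Δ')
  have hPDL := Model.isPDL_of_sharp hM
  have hmax' : ∀ e a b, R e a b → M.maxRel Δ _ (.base e) a b := by
    intro e a b hab x y hx hy φ hφ hbox
    obtain ⟨ψ, rfl⟩ := hg.2 φ
    exact (M.sat_pullback _ g ψ y).1 (hmax e a b hab x y hx hy ψ hφ
      ((M.sat_pullback _ g (.box e ψ) x).2 hbox))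
  refine ⟨.ofRel _ hsfin (fun x y hxy φ hφ => ?_) (sharpRel R)
    (hPDL.minRel_sharpRel (hΔ'fin.image _) hmin)
    (hPDL.sharpRel_maxRel hΓΔ hexp hΔ hmax'), mem_frames_sharp hf, _, hΔ'fin.image _, rfl⟩
  obtain ⟨ψ, rfl⟩ := hg.2 φ
  exact (M.sat_pullback _ g ψ x).symm.trans
    ((hs x y hxy ψ (hΓΔ hφ)).trans (M.sat_pullback _ g ψ y))

/-! ### Iterated expansions -/

/-- The embedding of `A` into its iterated expansions. -/
def SharpIter.base : (n : ℕ) → A → SharpIter A n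
  | 0 => id
  | n + 1 => Sharp.base ∘ SharpIter.base n

theorem SharpIter.base_injective (n : ℕ) : Function.Injective (SharpIter.base (A := A) n) := by
  induction n with
  | zero => exact Function.injective_id
  | succ n ih => exact Sharp.base_injective.comp ih

theorem SharpIter.countable [Countable A] (n : ℕ) : Countable (SharpIter A n) := by
  induction n with
  | zero => assumption
  | succ n ih => exact inferInstanceAs (Countable (Sharp (SharpIter A n)))

theorem Form.rename_id (φ : Form A) : φ.rename id = φ := by
  induction φ with
  | bot => rfl
  | var p => rfl
  | imp φ ψ h₁ h₂ => simp only [Form.rename, h₁, h₂]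
  | box e φ h => simp only [Form.rename, h, id]

theorem Form.rename_rename {B C : Type} (f : A → B) (g : B → C) (φ : Form A) :
    (φ.rename f).rename g = φ.rename (g ∘ f) := by
  induction φ with
  | bot => rfl
  | var p => rfl
  | imp φ ψ h₁ h₂ => simp only [Form.rename, h₁, h₂]
  | box e φ h => simp only [Form.rename, h, Function.comp]

theorem ModalLogic.rename_mem_sharpIter (L : ModalLogic A) (n : ℕ) {φ : Form A}
    (h : φ ∈ L.thms) : φ.rename (SharpIter.base n) ∈ (L.sharpIter n).thms := by
  induction n with
  | zero => exact (Form.rename_id φ).symm ▸ h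
  | succ n ih =>
    have := (L.sharpIter n).rename_mem_sharp ih
    rwa [Form.rename_rename] at this

theorem AdmitsDefinableFiltration.sharpIter [Countable A] {L : ModalLogic A} {K : Set (Frame A)}
    (hL : AdmitsDefinableFiltration L K) (n : ℕ) :
    AdmitsDefinableFiltration (L.sharpIter n) {F | F.reduct (SharpIter.base n) ∈ K} := by
  induction n with
  | zero => exact hL
  | succ n ih =>
    have := SharpIter.countable (A := A) n
    -- The two successive reducts are by definition the reduct along `SharpIter.base (n + 1)`.
    exact ih.sharp

end PDL

end ModalPDL

theorem mainTheorem5 (k : ℕ) (A : Fin k → Type) [∀ i, Finite (A i)]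
    (L : ∀ i, ModalPDL.ModalLogic (A i))
    (hcanonical : ∀ i, (L i).IsCanonical)
    (hfiltration : ∀ i, ModalPDL.AdmitsStrictFiltration (L i).frames)
    (n : ℕ) :
    ((ModalPDL.fusion L).sharpIter n).HasFMP := by
  have := ModalPDL.SharpIter.countable (A := Σ i, A i) n
  refine ((ModalPDL.fusion_admitsDefinableFiltration L hfiltration).sharpIter n).hasFMP fun h => ?_
  refine (ModalPDL.mem_frames_fusion L _).2 fun i => ?_
  -- Canonicity is applied directly along the embedding of `A i` into the iterated alphabet, so
  -- canonicity of the fusion is not needed separately.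
  refine (hcanonical i).reduct_mem_frames (f := ModalPDL.SharpIter.base n ∘ Sigma.mk i)
    ((ModalPDL.SharpIter.base_injective n).comp sigma_mk_injective) ?_ h
  rintro _ ⟨φ, hφ, rfl⟩
  rw [← ModalPDL.Form.rename_rename]
  exact (ModalPDL.fusion L).rename_mem_sharpIter n
    (ModalPDL.ModalLogic.subset_generate _ (Set.mem_iUnion.2 ⟨i, φ, hφ, rfl⟩))
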